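/- **Setting.** Work in the smooth category. Let $P$ be a closed connected oriented manifold of dimension $n$, let $M$ be a connected oriented manifold of dimension $m$, and let $\mathcal P$ be the set of smooth maps $P\to M$ with the $C^\infty$ topology. For $k\ge 1$ let $\widetilde{\mathcal N}_k$ be the space of multimarked maps from $k$ labelled copies $P_1,\dots,P_k$ of $P$ to $M$. A point of it consists of maps $f_1,\dots,f_k\in\mathcal P$ and a finite list of marks $\mathbf m_1,\dots,\mathbf m_l$ ($l\ge 0$), where a mark $\mathbf m$ is a finite (possibly empty) list of $|\mathbf m|$ points of $P_1\sqcup\dots\sqcup P_k$ with a grading $g(\mathbf m)\in\{1,2,\dots\}$, such that $f_1\sqcup\dots\sqcup f_k$ is constant on the points of each mark. For fixed $l$, gradings and numbers of points of the marks, these points form a subspace of $(P_1\sqcup\dots\sqcup P_k)^{\sum_i|\mathbf m_i|}\times\mathcal P^k$; $\widetilde{\mathcal N}_k$ is the disjoint union of these subspaces. Put $$\mathcal N=M\sqcup\coprod_{k\ge1}\widetilde{\mathcal N}_k/S_k ,$$ where $S_k$ permutes the copies of $P$. Let $\Omega_*$ be oriented bordism and $\mathbb O_i(\mathcal N)=\Omega_{i+m}(\mathcal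 N)$. **proj.** The homomorphism $\mathrm{proj}:\Omega_d(\mathcal N)\to\Omega_d(\mathcal N)$ is induced by the continuous map $\mathcal N\to\mathcal N$ that is the identity on $M$ and otherwise changes only the marks: a mark with $g(\mathbf m)\ne1$ gets grading $g(\mathbf m)-1$; a mark with $g(\mathbf m)=1$ and $|\mathbf m|>1$ gets grading $2$; a mark with $g(\mathbf m)=1$ and $|\mathbf m|=1$ is erased (and an empty mark of grading $1$ is left alone). **lift.** The operation $\mathrm{lift}$ raises dimension by $n$. It is given on singular manifolds with adjoint maps, that is, on closed oriented manifolds $F$ with a continuous map $\varphi:F\to M$ or $\varphi:F\to\widetilde{\mathcal N}_k$, the latter considered up to permutations of the copies of $P$. (A map from a connected manifold $F$ to $\mathcal N$ has an adjoint map $F\times N\to M$, $N=P_1\sqcup\dots\sqcup P_k$, as soon as it comes from such a $\varphi$.) For $\varphi:F\to M$, $\mathrm{lift}[F,\varphi]$ is the class of $F\times P\to F\xrightarrow{\varphi}M$. For $\varphi:F\to\widetilde{\mathcal N}_k$, $\mathrm{lift}[F,\varphi]$ is the class of $$F\times(P_1\sqcup\dots\sqcup P_k)\to\widetilde{\mathcal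 N}_k,\qquad (f,p)\mapsto\varphi(f)\text{ with the gradings of all its marks increased by }1\text{ and a new mark }\{p\}\text{ of grading }1 .$$ Let $\mathbb A_d=\Omega_d(M)\oplus\bigoplus_{k\ge1}\Omega_d(\widetilde{\mathcal N}_k)_{S_k}$ (coinvariants) be the bordism group of singular $d$-manifolds in $\mathcal N$ with adjoint maps up to permutations of the copies of $P$. Then $\mathrm{lift}:\mathbb A_d\to\mathbb A_{d+n}$ and $\mathrm{proj}:\mathbb A_d\to\mathbb A_d$ are homomorphisms. Let $c:\mathbb A_d\to\Omega_d(\mathcal N)$ be the homomorphism that forgets the adjoint maps. Say that $\beta\in\Omega_{d+n}(\mathcal N)$ is a value of $\mathrm{lift}$ on $\alpha\in\Omega_d(\mathcal N)$ if $\alpha=c(a)$ and $\beta=c(\mathrm{lift}(a))$ for some $a\in\mathbb A_d$. **Proposition 4.3.** Suppose that $P$ is an oriented boundary, i.e. $P=\partial W$ for some compact oriented manifold $W$ with boundary. Then $\mathrm{proj}\circ\mathrm{lift}=0$ in every degree: the homomorphism $\mathrm{proj}\circ\mathrm{lift}:\mathbb A_d\to\mathbb A_{d+n}$ is zero for all $d\ge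 0$, and in the bordism groups of the space $\mathcal N$ itself, $\mathrm{proj}(\beta)=0$ for every $\alpha\in\Omega_d(\mathcal N)$ and every value $\beta\in\Omega_{d+n}(\mathcal N)$ of $\mathrm{lift}$ on $\alpha$. -/

import Mathlib

open scoped Manifold ContDiff Topology
open Module Set Topology

universe u v w

noncomputable section

namespace Garlands

/-! ### Oriented manifolds -/

/-- An orientation of a smooth manifold `X` modelled on `I : ModelWithCorners ℝ E H`, relative to an
orientation of the model vector space `E` that is chosen once and for all.  It records, for every
point `x`, whether the preferred chart at `x` preserves (`1`) or reverses (`-1`) the orientation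
at `x`.  This sign must be locally constant: for `y` near `x`, the two signs differ by the sign of
the Jacobian determinant at `y` of the change of coordinates from the chart at `y` to the one
at `x`. -/
structure ManifoldOrientation {E H : Type*} [NormedAddCommGroup E] [NormedSpace ℝ E]
    [TopologicalSpace H] (I : ModelWithCorners ℝ E H) (X : Type*) [TopologicalSpace X]
    [ChartedSpace H X] where
  sign : X → ℤˣ
  coherent : ∀ x : X, ∀ᶠ y in 𝓝 x,
    0 < (((sign x * sign y : ℤˣ) : ℤ) : ℝ) *
      (fderivWithin ℝ (extChartAt I x ∘ (extChartAt I y).symm) (range I) (extChartAt I y y)).det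

/-- Closed (compact, without boundary, possibly empty or disconnected) oriented smooth manifolds of
dimension `d`.  The model vector space is any `d`-dimensional real normed space, oriented by the
basis `basis`. -/
structure ClosedManifold (d : ℕ) : Type (u + 1) where
  carrier : Type u
  E : Type
  H : Type
  [normedAddCommGroup : NormedAddCommGroup E]
  [normedSpace : NormedSpace ℝ E]
  [topH : TopologicalSpace H]
  [top : TopologicalSpace carrier]
  [charted : ChartedSpace H carrier]
  I : ModelWithCorners ℝ E H
  [boundaryless : I.Boundaryless]
  [isManifold : IsManifold I ∞ carrier]
  [compact : CompactSpace carrier]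
  [t2 : T2Space carrier]
  basis : Basis (Fin d) ℝ E
  orientation : ManifoldOrientation I carrier

attribute [instance] ClosedManifold.normedAddCommGroup ClosedManifold.normedSpace
  ClosedManifold.topH ClosedManifold.top ClosedManifold.charted ClosedManifold.boundaryless
  ClosedManifold.isManifold ClosedManifold.compact ClosedManifold.t2

/-- Compact oriented smooth manifolds with boundary, of dimension `d`.  The model is a closed
half-space `{v | 0 ≤ ℓ v}` of a `d`-dimensional real normed space oriented by `basis`. -/
structure BoundedManifold (d : ℕ) : Type (u + 1) where
  carrier : Type u
  E : Type
  H : Type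
  [normedAddCommGroup : NormedAddCommGroup E]
  [normedSpace : NormedSpace ℝ E]
  [topH : TopologicalSpace H]
  [top : TopologicalSpace carrier]
  [charted : ChartedSpace H carrier]
  I : ModelWithCorners ℝ E H
  ℓ : E →L[ℝ] ℝ
  ℓ_ne_zero : ℓ ≠ 0
  range_I : range I = {v | 0 ≤ ℓ v}
  [isManifold : IsManifold I ∞ carrier]
  [compact : CompactSpace carrier]
  [t2 : T2Space carrier]
  basis : Basis (Fin d) ℝ E
  orientation : ManifoldOrientation I carrier

attribute [instance] BoundedManifold.normedAddCommGroup BoundedManifold.normedSpace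
  BoundedManifold.topH BoundedManifold.top BoundedManifold.charted
  BoundedManifold.isManifold BoundedManifold.compact BoundedManifold.t2

/-- The oriented boundary of `W` is the disjoint union of the closed oriented manifolds `F j`,
identified with parts of `∂W` through the maps `e j`.  Orientations follow the convention "outward
normal first": in the preferred charts, a tangent vector `ν` of `W` at a boundary point is outward
pointing iff `ℓ ν < 0`, and `(ν, de v₁, …, de v_d)` has to be a positive frame of `W` whenever
`(v₁, …, v_d)` is a positive frame of `F j`.  (The sign does not depend on the choice of `ν`, as the
image of `de` is the hyperplane `ker ℓ`; in particular `e j` is an immersion.) -/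
structure IsOrientedBoundary {d r : ℕ} (W : BoundedManifold.{u} (d + 1))
    (F : Fin r → ClosedManifold.{u} d) (e : ∀ j, (F j).carrier → W.carrier) : Prop where
  smooth : ∀ j, ContMDiff (F j).I W.I ∞ (e j)
  embedding : ∀ j, IsEmbedding (e j)
  disjoint : Pairwise fun i j => Disjoint (range (e i)) (range (e j))
  range_eq : ⋃ j, range (e j) = W.I.boundary W.carrier
  oriented : ∀ j (x : (F j).carrier), ∃ ν : W.E, W.ℓ ν < 0 ∧
    0 < ((((F j).orientation.sign x * W.orientation.sign (e j x) : ℤˣ) : ℤ) : ℝ) *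
      W.basis.det (Fin.cons ν fun i => (mfderiv (F j).I W.I (e j) x ((F j).basis i) : W.E))

/-- `F` is an oriented boundary: `F = ∂W` for some compact oriented manifold `W`. -/
def ClosedManifold.IsBoundary {d : ℕ} (F : ClosedManifold.{u} d) : Prop :=
  ∃ (W : BoundedManifold.{u} (d + 1)) (e : ∀ _ : Fin 1, F.carrier → W.carrier),
    IsOrientedBoundary W (fun _ => F) e

/-! ### Products with a closed manifold -/

lemma coherent_prod {E H E' H' : Type*} [NormedAddCommGroup E] [NormedSpace ℝ E]
    [TopologicalSpace H] (I : ModelWithCorners ℝ E H) (X : Type*) [TopologicalSpace X]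
    [ChartedSpace H X] [NormedAddCommGroup E'] [NormedSpace ℝ E'] [TopologicalSpace H']
    (I' : ModelWithCorners ℝ E' H') (X' : Type*) [TopologicalSpace X'] [ChartedSpace H' X']
    [FiniteDimensional ℝ E] [FiniteDimensional ℝ E']
    [IsManifold I ∞ X] [IsManifold I' ∞ X'] {x y : X} {x' y' : X'}
    (hy : y ∈ (extChartAt I x).source) (hy' : y' ∈ (extChartAt I' x').source) :
    (fderivWithin ℝ (extChartAt (I.prod I') (x, x') ∘ (extChartAt (I.prod I') (y, y')).symm)
      (range (I.prod I')) (extChartAt (I.prod I') (y, y') (y, y'))).det =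
    (fderivWithin ℝ (extChartAt I x ∘ (extChartAt I y).symm) (range I) (extChartAt I y y)).det *
    (fderivWithin ℝ (extChartAt I' x' ∘ (extChartAt I' y').symm) (range I')
      (extChartAt I' y' y')).det := by
  have : IsManifold I 1 X := IsManifold.of_le (n := ∞) (by norm_num)
  have : IsManifold I' 1 X' := IsManifold.of_le (n := ∞) (by norm_num)
  have h := hasFDerivWithinAt_tangentCoordChange (I := I) (x := y) (y := x) (z := y)
    ⟨mem_extChartAt_source y, hy⟩
  have h' := hasFDerivWithinAt_tangentCoordChange (I := I') (x := y') (y := x') (z := y')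
    ⟨mem_extChartAt_source y', hy'⟩
  have u1 := I.uniqueDiffWithinAt_image (x := chartAt H y y)
  have u2 := I'.uniqueDiffWithinAt_image (x := chartAt H' y' y')
  have hp : HasFDerivWithinAt
      (extChartAt (I.prod I') (x, x') ∘ (extChartAt (I.prod I') (y, y')).symm)
      ((tangentCoordChange I y x y).prodMap (tangentCoordChange I' y' x' y'))
      (range (I.prod I')) (extChartAt (I.prod I') (y, y') (y, y')) := by
    rw [extChartAt_prod, extChartAt_prod, ModelWithCorners.range_prod]
    refine HasFDerivWithinAt.prodMap (f := extChartAt I x ∘ (extChartAt I y).symm)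
      (f₂ := extChartAt I' x' ∘ (extChartAt I' y').symm) (extChartAt I y y, extChartAt I' y' y')
      (h.mono (fst_image_prod_subset ..)) (h'.mono (snd_image_prod_subset ..))
  have up : UniqueDiffWithinAt ℝ (range (I.prod I'))
      (extChartAt (I.prod I') (y, y') (y, y')) := by
    rw [extChartAt_prod, ModelWithCorners.range_prod]
    exact UniqueDiffWithinAt.prod u1 u2
  rw [hp.fderivWithin up, h.fderivWithin u1, h'.fderivWithin u2]
  exact LinearMap.det_prodMap _ _

/-- The product orientation. -/
def ManifoldOrientation.prod {E H E' H' : Type*} [NormedAddCommGroup E] [NormedSpace ℝ E]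
    [TopologicalSpace H] {I : ModelWithCorners ℝ E H} {X : Type*} [TopologicalSpace X]
    [ChartedSpace H X] [NormedAddCommGroup E'] [NormedSpace ℝ E'] [TopologicalSpace H']
    {I' : ModelWithCorners ℝ E' H'} {X' : Type*} [TopologicalSpace X'] [ChartedSpace H' X']
    [FiniteDimensional ℝ E] [FiniteDimensional ℝ E']
    [IsManifold I ∞ X] [IsManifold I' ∞ X']
    (o : ManifoldOrientation I X) (o' : ManifoldOrientation I' X') :
    ManifoldOrientation (I.prod I') (X × X') where
  sign x := o.sign x.1 * o'.sign x.2
  coherent := by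
    rintro ⟨x, x'⟩
    rw [nhds_prod_eq]
    filter_upwards [((o.coherent x).and (extChartAt_source_mem_nhds (I := I) x)).prod_mk
      ((o'.coherent x').and (extChartAt_source_mem_nhds (I := I') x'))]
    rintro ⟨y, y'⟩ ⟨⟨h1, h2⟩, h3, h4⟩
    rw [coherent_prod I X I' X' h2 h4]
    have := mul_pos h1 h3
    push_cast at this ⊢
    linarith

/-- The product of two closed oriented manifolds, with the product orientation (first factor
first). -/
def ClosedManifold.prod {d n : ℕ} (F : ClosedManifold.{u} d) (P : ClosedManifold.{u} n) :
    ClosedManifold.{u} (d + n) :=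
  haveI := F.basis.finiteDimensional_of_finite
  haveI := P.basis.finiteDimensional_of_finite
  { carrier := F.carrier × P.carrier
    E := F.E × P.E
    H := ModelProd F.H P.H
    I := F.I.prod P.I
    basis := (F.basis.prod P.basis).reindex finSumFinEquiv
    orientation := F.orientation.prod P.orientation }

/-- The product of a compact oriented manifold with boundary and a closed oriented manifold. -/
def BoundedManifold.prod {d n : ℕ} (W : BoundedManifold.{u} (d + 1)) (P : ClosedManifold.{u} n) :
    BoundedManifold.{u} (d + n + 1) :=
  haveI := W.basis.finiteDimensional_of_finite
  haveI := P.basis.finiteDimensional_of_finite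
  { carrier := W.carrier × P.carrier
    E := W.E × P.E
    H := ModelProd W.H P.H
    I := W.I.prod P.I
    ℓ := W.ℓ.comp (ContinuousLinearMap.fst ℝ W.E P.E)
    ℓ_ne_zero := fun h => W.ℓ_ne_zero <| by
      ext x
      simpa using congrArg (fun f => f (x, 0)) h
    range_I := by
      rw [ModelWithCorners.range_prod, W.range_I, P.I.range_eq_univ]
      ext x
      simp
    basis := ((W.basis.prod P.basis).reindex finSumFinEquiv).reindex (finCongr (by omega))
    orientation := W.orientation.prod P.orientation }

lemma det_prod_cons {d n : ℕ} {E E' V : Type*} [AddCommGroup E] [Module ℝ E] [AddCommGroup E']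
    [Module ℝ E'] [AddCommGroup V] [Module ℝ V] (b : Basis (Fin (d + 1)) ℝ E)
    (b' : Basis (Fin n) ℝ E') (c : Basis (Fin d) ℝ V) (A : V → E) (hA : A 0 = 0) (ν : E)
    (h : d + 1 + n = d + n + 1) :
    (((b.prod b').reindex finSumFinEquiv).reindex (finCongr h)).det
      (Fin.cons (ν, 0) fun i => Prod.map A id (((c.prod b').reindex finSumFinEquiv) i)) =
    b.det (Fin.cons ν fun i => A (c i)) := by
  rw [Basis.det_reindex, Basis.det_reindex, Basis.det_apply, Basis.det_apply]
  have key : ((Fin.cons (ν, 0) fun i => Prod.map A id (((c.prod b').reindex finSumFinEquiv) i) :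
        Fin (d + n + 1) → E × E') ∘ finCongr h) ∘ finSumFinEquiv =
      Sum.elim (fun i => ((Fin.cons ν fun i => A (c i) : Fin (d + 1) → E) i, 0))
        (fun j => (0, b' j)) := by
    funext s
    rcases s with i | j
    · refine Fin.cases ?_ (fun i => ?_) i
      · have : finCongr h (finSumFinEquiv (Sum.inl (0 : Fin (d + 1)))) = (0 : Fin (d + n + 1)) := by
          ext; simp
        simp only [Function.comp_apply, this, Fin.cons_zero, Sum.elim_inl]
      · have : finCongr h (finSumFinEquiv (Sum.inl i.succ)) =
            (finSumFinEquiv (Sum.inl i : Fin d ⊕ Fin n)).succ := by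
          ext; simp
        simp only [Function.comp_apply, this, Fin.cons_succ, Sum.elim_inl]
        simp [Basis.reindex_apply]
    · have : finCongr h (finSumFinEquiv (Sum.inr j : Fin (d + 1) ⊕ Fin n)) =
          (finSumFinEquiv (Sum.inr j : Fin d ⊕ Fin n)).succ := by
        ext; simp; omega
      simp only [Function.comp_apply, this, Fin.cons_succ, Sum.elim_inr]
      simp [Basis.reindex_apply, hA]
  rw [key]
  have : (b.prod b').toMatrix (Sum.elim
      (fun i => ((Fin.cons ν fun i => A (c i) : Fin (d + 1) → E) i, 0)) (fun j => (0, b' j))) =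
      Matrix.fromBlocks (b.toMatrix (Fin.cons ν fun i => A (c i))) 0 0 1 := by
    ext s t
    rcases s with s | s <;> rcases t with t | t <;>
      simp [Basis.toMatrix_apply, Matrix.one_apply, Finsupp.single_apply, eq_comm]
  rw [this, Matrix.det_fromBlocks_zero₁₂, Matrix.det_one, mul_one]

lemma IsOrientedBoundary.prod {d n r : ℕ} {W : BoundedManifold.{u} (d + 1)}
    {F : Fin r → ClosedManifold.{u} d} {e : ∀ j, (F j).carrier → W.carrier}
    (h : IsOrientedBoundary W F e) (P : ClosedManifold.{u} n) :
    IsOrientedBoundary (W.prod P) (fun j => (F j).prod P) (fun j => Prod.map (e j) id) where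
  smooth j := (h.smooth j).prodMap contMDiff_id
  embedding j := (h.embedding j).prodMap .id
  disjoint i j hij := by
    refine Set.disjoint_left.2 ?_
    rintro _ ⟨x, rfl⟩ ⟨y, hy⟩
    exact Set.disjoint_left.1 (h.disjoint hij) ⟨x.1, rfl⟩ ⟨y.1, congrArg Prod.fst hy⟩
  range_eq := by
    have : (W.prod P).I.boundary (W.prod P).carrier =
        (W.I.boundary W.carrier) ×ˢ (univ : Set P.carrier) :=
      ModelWithCorners.boundary_of_boundaryless_right
    rw [this, ← h.range_eq]
    ext x
    constructor
    · rintro ⟨_, ⟨j, rfl⟩, y, rfl⟩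
      exact ⟨mem_iUnion.2 ⟨j, y.1, rfl⟩, trivial⟩
    · rintro ⟨hx, -⟩
      obtain ⟨j, y, hy⟩ := mem_iUnion.1 hx
      exact mem_iUnion.2 ⟨j, (y, x.2), Prod.ext hy rfl⟩
  oriented j x := by
    obtain ⟨ν, hν, hpos⟩ := h.oriented j x.1
    refine ⟨(ν, 0), hν, ?_⟩
    have hm : mfderiv ((F j).I.prod P.I) (W.I.prod P.I) (Prod.map (e j) id) x =
        (mfderiv (F j).I W.I (e j) x.1).prodMap (mfderiv P.I P.I id x.2) :=
      mfderiv_prodMap (p := x) (((h.smooth j).mdifferentiable (by simp)) x.1)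
        (mdifferentiableAt_id (I := P.I) (x := x.2))
    rw [mfderiv_id] at hm
    have hd := det_prod_cons W.basis P.basis (F j).basis
      (fun v => (mfderiv (F j).I W.I (e j) x.1 v : W.E)) (map_zero _) ν (by omega)
    refine lt_of_lt_of_eq hpos ?_
    have hs : (((F j).prod P).orientation.sign x *
        (W.prod P).orientation.sign (Prod.map (e j) id x) : ℤˣ) =
        (F j).orientation.sign x.1 * W.orientation.sign (e j x.1) := by
      change ((F j).orientation.sign x.1 * P.orientation.sign x.2) *
        (W.orientation.sign (e j x.1) * P.orientation.sign x.2) = _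
      rw [mul_mul_mul_comm, Int.units_mul_self, mul_one]
    rw [hs, ← hd]
    refine congrArg _ (congrArg _ (congrArg (Fin.cons _) (funext fun i => ?_)))
    exact (DFunLike.congr_fun hm (((F j).basis.prod P.basis).reindex finSumFinEquiv i)).symm

/-! ### Oriented bordism groups -/

/-- Singular closed oriented `d`-manifolds in `X`: pairs `(F, f)` with `f : F → X` continuous. -/
structure SingularManifold (d : ℕ) (X : Type w) [TopologicalSpace X] : Type (max (u + 1) w) where
  F : ClosedManifold.{u} d
  f : C(F.carrier, X)

/-- The elements `∑ j, [F j, Φ ∘ e j]`, where `(W, Φ)` is a singular compact oriented manifold whose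
oriented boundary is the disjoint union of the `F j`. -/
def boundaryRelations (d : ℕ) (X : Type w) [TopologicalSpace X] :
    Set (FreeAbelianGroup (SingularManifold.{u} d X)) :=
  {z | ∃ (W : BoundedManifold.{u} (d + 1)) (Φ : C(W.carrier, X)) (r : ℕ)
      (s : Fin r → SingularManifold.{u} d X) (e : ∀ j, (s j).F.carrier → W.carrier),
      IsOrientedBoundary W (fun j => (s j).F) e ∧ (∀ j x, (s j).f x = Φ (e j x)) ∧
      z = ∑ j, FreeAbelianGroup.of (s j)}

/-- The oriented bordism group `Ω_d(X)`: generated by the singular closed oriented `d`-manifolds in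
`X`, subject to the relations that disjoint unions of such which are the oriented boundary of a
singular compact oriented manifold vanish.  The boundaries of cylinders show that in this group
`[F ⊔ G] = [F] + [G]` and `[-F] = -[F]` (and that diffeomorphic or homotopic singular manifolds
agree), so every element is the class of a single singular manifold, and that class vanishes iff the
singular manifold bounds: this is the usual group of bordism classes under disjoint union. -/
def Bordism (d : ℕ) (X : Type w) [TopologicalSpace X] : Type (max (u + 1) w) :=
  FreeAbelianGroup (SingularManifold.{u} d X) ⧸ AddSubgroup.closure (boundaryRelations.{u} d X)

instance (d : ℕ) (X : Type w) [TopologicalSpace X] : AddCommGroup (Bordism.{u} d X) :=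
  inferInstanceAs (AddCommGroup (_ ⧸ AddSubgroup.closure (boundaryRelations.{u} d X)))

namespace Bordism

/-- The quotient map. -/
def quot (d : ℕ) (X : Type w) [TopologicalSpace X] :
    FreeAbelianGroup (SingularManifold.{u} d X) →+ Bordism.{u} d X :=
  QuotientAddGroup.mk' (AddSubgroup.closure (boundaryRelations.{u} d X))

/-- The bordism class of a singular manifold. -/
def mk {d : ℕ} {X : Type w} [TopologicalSpace X] (s : SingularManifold.{u} d X) :
    Bordism.{u} d X :=
  quot d X (FreeAbelianGroup.of s)

/-- A map on singular manifolds that respects the boundary relations extends to the bordism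
group. -/
def lift {d : ℕ} {X : Type w} [TopologicalSpace X] {A : Type*} [AddCommGroup A]
    (g : SingularManifold.{u} d X → A)
    (hg : ∀ (W : BoundedManifold.{u} (d + 1)) (Φ : C(W.carrier, X)) (r : ℕ)
      (s : Fin r → SingularManifold.{u} d X) (e : ∀ j, (s j).F.carrier → W.carrier),
      IsOrientedBoundary W (fun j => (s j).F) e → (∀ j x, (s j).f x = Φ (e j x)) →
      ∑ j, g (s j) = 0) : Bordism.{u} d X →+ A :=
  QuotientAddGroup.lift _ (FreeAbelianGroup.lift g) <| by
    rw [AddSubgroup.closure_le]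
    rintro _ ⟨W, Φ, r, s, e, h1, h2, rfl⟩
    simpa [AddMonoidHom.mem_ker] using hg W Φ r s e h1 h2

@[simp] lemma lift_mk {d : ℕ} {X : Type w} [TopologicalSpace X] {A : Type*} [AddCommGroup A]
    (g : SingularManifold.{u} d X → A) (hg) (s : SingularManifold.{u} d X) :
    lift g hg (mk s) = g s :=
  FreeAbelianGroup.lift_apply_of g s

lemma sum_mk_eq_zero {d : ℕ} {X : Type w} [TopologicalSpace X] (W : BoundedManifold.{u} (d + 1))
    (Φ : C(W.carrier, X)) (r : ℕ) (s : Fin r → SingularManifold.{u} d X)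
    (e : ∀ j, (s j).F.carrier → W.carrier) (h1 : IsOrientedBoundary W (fun j => (s j).F) e)
    (h2 : ∀ j x, (s j).f x = Φ (e j x)) : ∑ j, mk (s j) = 0 := by
  unfold mk
  rw [← map_sum]
  exact (QuotientAddGroup.eq_zero_iff _).2 (AddSubgroup.subset_closure ⟨W, Φ, r, s, e, h1, h2, rfl⟩)

lemma hom_ext {d : ℕ} {X : Type w} [TopologicalSpace X] {A : Type*} [AddCommGroup A]
    {f g : Bordism.{u} d X →+ A} (h : ∀ s, f (mk s) = g (mk s)) : f = g := by
  refine QuotientAddGroup.addMonoidHom_ext _ (FreeAbelianGroup.lift.symm.injective ?_)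
  funext s
  exact h s

/-- The homomorphism `g_* : Ω_d(X) → Ω_d(Y)`, `[F, f] ↦ [F, g ∘ f]`. -/
def map {d : ℕ} {X Y : Type*} [TopologicalSpace X] [TopologicalSpace Y] (g : C(X, Y)) :
    Bordism.{u} d X →+ Bordism.{u} d Y :=
  lift (fun s => mk ⟨s.F, g.comp s.f⟩) fun W Φ r s e h1 h2 =>
    sum_mk_eq_zero W (g.comp Φ) r (fun j => ⟨(s j).F, g.comp (s j).f⟩) e h1
      fun j x => congrArg g (h2 j x)

lemma map_mk {d : ℕ} {X Y : Type*} [TopologicalSpace X] [TopologicalSpace Y] (g : C(X, Y))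
    (s : SingularManifold.{u} d X) : map g (mk s) = mk ⟨s.F, g.comp s.f⟩ :=
  lift_mk _ _ s

/-- For a continuous `g : X × P → Y`, the homomorphism `Ω_d(X) → Ω_{d+n}(Y)` that sends `[F, f]` to
the class of `F × P → Y, (x, p) ↦ g (f x, p)`. -/
def cross {d n : ℕ} {X Y : Type*} [TopologicalSpace X] [TopologicalSpace Y]
    (P : ClosedManifold.{u} n) (g : C(X × P.carrier, Y)) :
    Bordism.{u} d X →+ Bordism.{u} (d + n) Y :=
  lift (fun s => mk ⟨s.F.prod P, g.comp (s.f.prodMap (ContinuousMap.id _))⟩)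
    fun W Φ r s e h1 h2 =>
      sum_mk_eq_zero (W.prod P) (g.comp (Φ.prodMap (ContinuousMap.id _))) r
        (fun j => ⟨(s j).F.prod P, g.comp ((s j).f.prodMap (ContinuousMap.id _))⟩)
        (fun j => Prod.map (e j) id) (h1.prod P)
        fun j x => congrArg g (Prod.ext (h2 j x.1) rfl)

lemma cross_mk {d n : ℕ} {X Y : Type*} [TopologicalSpace X] [TopologicalSpace Y]
    (P : ClosedManifold.{u} n) (g : C(X × P.carrier, Y)) (s : SingularManifold.{u} d X) :
    cross P g (mk s) = mk ⟨s.F.prod P, g.comp (s.f.prodMap (ContinuousMap.id _))⟩ :=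
  lift_mk _ _ s

end Bordism

/-! ### Garlands -/

/-- An unbundled closed oriented `n`-manifold, as a `ClosedManifold`. -/
abbrev ClosedManifold.of (n : ℕ) (P : Type u) [TopologicalSpace P]
    [ChartedSpace (EuclideanSpace ℝ (Fin n)) P] [IsManifold (𝓡 n) ∞ P] [CompactSpace P] [T2Space P]
    (o : ManifoldOrientation (𝓡 n) P) : ClosedManifold.{u} n where
  carrier := P
  E := EuclideanSpace ℝ (Fin n)
  H := EuclideanSpace ℝ (Fin n)
  I := 𝓡 n
  basis := (EuclideanSpace.basisFun (Fin n) ℝ).toBasis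
  orientation := o

section

variable (n m : ℕ) (P : Type u) [TopologicalSpace P] [ChartedSpace (EuclideanSpace ℝ (Fin n)) P]
  (M : Type v) [TopologicalSpace M] [ChartedSpace (EuclideanSpace ℝ (Fin m)) M]

/-- The set `𝒫` of smooth maps `P → M`. -/
abbrev SmoothMaps : Type (max u v) := C^∞⟮𝓡 n, P; 𝓡 m, M⟯

/-- The `C^∞` topology on `𝒫`.  A subbasis is given by the sets of the maps `g` which, in charts `φ`
of `P` and `ψ` of `M` and on a compact set `K` in the domain of `φ`, are `ε`-close to a given map
`f` together with all derivatives up to some order `r`. -/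
instance : TopologicalSpace (SmoothMaps n m P M) :=
  TopologicalSpace.generateFrom
    {S | ∃ (f : SmoothMaps n m P M) (φ : OpenPartialHomeomorph P (EuclideanSpace ℝ (Fin n)))
      (ψ : OpenPartialHomeomorph M (EuclideanSpace ℝ (Fin m))) (K : Set P) (r : ℕ) (ε : ℝ),
      φ ∈ IsManifold.maximalAtlas (𝓡 n) ∞ P ∧ ψ ∈ IsManifold.maximalAtlas (𝓡 m) ∞ M ∧
      IsCompact K ∧ K ⊆ φ.source ∧ MapsTo f K ψ.source ∧ 0 < ε ∧
      S = {g : SmoothMaps n m P M | MapsTo g K ψ.source ∧ ∀ x ∈ K, ∀ i ≤ r,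
        ‖iteratedFDeriv ℝ i (ψ ∘ g ∘ φ.symm) (φ x) - iteratedFDeriv ℝ i (ψ ∘ f ∘ φ.symm) (φ x)‖
          < ε}}

/-- Multimarked maps `P₁ ⊔ ⋯ ⊔ P_k → M` on `k` labelled copies of `P`.  The disjoint union is
`Fin k × P`, a map on it is a family `f : Fin k → 𝒫`, a graded mark is a pair consisting of its
grading (a positive integer) and a finite, possibly empty, list of points of `Fin k × P`, and a
multimark is a finite list of graded marks.  Each mark has to be mapped to one point of `M`.
The topology is the subspace topology, where lists carry the topology of the disjoint union of the
finite powers, and numbers are discrete; so there is one open and closed piece for each number `l`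
of marks, gradings `g₁, …, g_l` and numbers of elements of the marks, and it is a subspace of a
product of a power of `Fin k × P` and `𝒫^k`. -/
def LabelledGarland (k : ℕ) : Type (max u v) :=
  {x : List (ℕ × List (Fin k × P)) × (Fin k → SmoothMaps n m P M) //
    ∀ μ ∈ x.1, 1 ≤ μ.1 ∧ ∀ q ∈ μ.2, ∀ q' ∈ μ.2, x.2 q.1 q.2 = x.2 q'.1 q'.2}

instance (k : ℕ) : TopologicalSpace (LabelledGarland n m P M k) :=
  inferInstanceAs (TopologicalSpace (Subtype _))

end

lemma continuous_filterMap {α β : Type*} [TopologicalSpace α] [TopologicalSpace β]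
    (h : α → Option β)
    (hh : ∀ a, (∀ᶠ a' in 𝓝 a, h a' = none) ∨
      ∃ h' : α → β, ContinuousAt h' a ∧ ∀ᶠ a' in 𝓝 a, h a' = some (h' a')) :
    Continuous (List.filterMap h) := by
  refine continuous_iff_continuousAt.2 (List.tendsto_nhds ?_ ?_)
  · rw [List.filterMap_nil, nhds_nil]
    exact Filter.tendsto_pure_pure _ _
  · intro l a ih
    rcases hh a with h0 | ⟨h', hc, h1⟩
    · have := h0.self_of_nhds
      rw [List.filterMap_cons_none this]
      refine (ih.comp Filter.tendsto_snd).congr' ?_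
      filter_upwards [Filter.tendsto_fst.eventually h0] with p hp
      exact (List.filterMap_cons_none hp).symm
    · have := h1.self_of_nhds
      rw [List.filterMap_cons_some this]
      refine Filter.Tendsto.congr' ?_
        ((hc.tendsto.comp Filter.tendsto_fst).cons (ih.comp Filter.tendsto_snd))
      filter_upwards [Filter.tendsto_fst.eventually h1] with p hp
      exact (List.filterMap_cons_some hp).symm

lemma continuous_listMap {α β : Type*} [TopologicalSpace α] [TopologicalSpace β]
    {h : α → β} (hh : Continuous h) : Continuous (List.map h) := by
  rw [← List.filterMap_eq_map]
  exact continuous_filterMap _ fun a => Or.inr ⟨h, hh.continuousAt, .of_forall fun _ => rfl⟩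

/-- The effect of `proj` on a graded mark `(g, q)`: if `g ≠ 1`, the grading decreases by `1`; if
`g = 1` and the mark has more than one element, the grading increases by `1`; if `g = 1` and the
mark has one element, the mark is erased.  (An empty mark of grading `1` is left alone.) -/
def projMark {Q : Type*} (μ : ℕ × List Q) : Option (ℕ × List Q) :=
  if μ.1 ≠ 1 then some (μ.1 - 1, μ.2)
  else if 1 < μ.2.length then some (μ.1 + 1, μ.2)
  else if μ.2.length = 1 then none
  else some μ

lemma projMark_continuous {Q : Type*} [TopologicalSpace Q] :
    Continuous (List.filterMap (projMark (Q := Q))) := by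
  refine continuous_filterMap _ fun a => ?_
  have h1 : ∀ᶠ a' : ℕ × List Q in 𝓝 a, a'.1 = a.1 :=
    (continuous_fst.tendsto a).eventually
      (p := fun g => g = a.1) (by rw [nhds_discrete]; exact Filter.eventually_pure.2 rfl)
  have h2 : ∀ᶠ a' : ℕ × List Q in 𝓝 a, a'.2.length = a.2.length :=
    ((List.continuousAt_length a.2).tendsto.comp (continuous_snd.tendsto a)).eventually
      (p := fun g => g = a.2.length) (by rw [nhds_discrete]; exact Filter.eventually_pure.2 rfl)
  unfold projMark
  by_cases c1 : a.1 = 1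
  · by_cases c2 : 1 < a.2.length
    · refine Or.inr ⟨fun μ => (μ.1 + 1, μ.2), by fun_prop, ?_⟩
      filter_upwards [h1, h2] with b hb1 hb2
      simp [hb1, hb2, c1, c2]
    · by_cases c3 : a.2.length = 1
      · left
        filter_upwards [h1, h2] with b hb1 hb2
        simp [hb1, hb2, c1, c3]
      · refine Or.inr ⟨id, continuousAt_id, ?_⟩
        filter_upwards [h1, h2] with b hb1 hb2
        simp [hb1, hb2, c1, c2, c3]
  · refine Or.inr ⟨fun μ => (μ.1 - 1, μ.2), by fun_prop, ?_⟩
    filter_upwards [h1, h2] with b hb1 hb2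
    simp [hb1, c1]

namespace LabelledGarland

variable {n m : ℕ} {P : Type u} [TopologicalSpace P] [ChartedSpace (EuclideanSpace ℝ (Fin n)) P]
  {M : Type v} [TopologicalSpace M] [ChartedSpace (EuclideanSpace ℝ (Fin m)) M] {k : ℕ}

/-- The action of a permutation of the copies of `P`. -/
def relabel (σ : Equiv.Perm (Fin k)) :
    C(LabelledGarland n m P M k, LabelledGarland n m P M k) where
  toFun x := ⟨(x.1.1.map fun μ => (μ.1, μ.2.map fun q => (σ q.1, q.2)), fun i => x.1.2 (σ.symm i)), by
    intro μ hμ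
    obtain ⟨μ', h, rfl⟩ := List.mem_map.1 hμ
    refine ⟨(x.2 μ' h).1, fun q hq q' hq' => ?_⟩
    obtain ⟨r, hr, rfl⟩ := List.mem_map.1 hq
    obtain ⟨r', hr', rfl⟩ := List.mem_map.1 hq'
    simpa using (x.2 μ' h).2 r hr r' hr'⟩
  continuous_toFun := by
    refine Continuous.subtype_mk (Continuous.prodMk ?_ ?_) _
    · refine (continuous_listMap ?_).comp (continuous_fst.comp continuous_subtype_val)
      refine continuous_fst.prodMk ((continuous_listMap ?_).comp continuous_snd)
      exact (continuous_of_discreteTopology.comp continuous_fst).prodMk continuous_snd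
    · exact continuous_pi fun i => (continuous_apply _).comp
        (continuous_snd.comp continuous_subtype_val)

lemma relabel_one (x : LabelledGarland n m P M k) : relabel 1 x = x := by
  apply Subtype.ext
  apply Prod.ext
  · change List.map (fun μ => (μ.1, List.map id μ.2)) x.1.1 = _
    simp
  · rfl

lemma relabel_mul (σ τ : Equiv.Perm (Fin k)) (x : LabelledGarland n m P M k) :
    relabel (σ * τ) x = relabel σ (relabel τ x) := by
  apply Subtype.ext
  apply Prod.ext
  · change List.map _ x.1.1 = List.map _ (List.map _ x.1.1)
    simp
  · rfl

/-- Two labelled garlands are equivalent if they agree up to a permutation of the copies of `P`. -/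
instance setoid : Setoid (LabelledGarland n m P M k) where
  r x y := ∃ σ, relabel σ x = y
  iseqv :=
    { refl := fun x => ⟨1, relabel_one x⟩
      symm := by
        rintro x _ ⟨σ, rfl⟩
        exact ⟨σ⁻¹, by rw [← relabel_mul, inv_mul_cancel, relabel_one]⟩
      trans := by
        rintro x _ _ ⟨σ, rfl⟩ ⟨τ, rfl⟩
        exact ⟨τ * σ, relabel_mul _ _ _⟩ }

/-- Given the copy `j` of `P` and a point `p` of it, add the mark `{p}` with grading `1`, and
increase the grading of all other marks by `1`. -/
def addMark (j : Fin k) : C(LabelledGarland n m P M k × P, LabelledGarland n m P M k) where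
  toFun x := ⟨((1, [(j, x.2)]) :: x.1.1.1.map fun μ => (μ.1 + 1, μ.2), x.1.1.2), by
    intro μ hμ
    rcases List.mem_cons.1 hμ with rfl | hμ
    · simp
    · obtain ⟨μ', h, rfl⟩ := List.mem_map.1 hμ
      exact ⟨Nat.le_add_left _ _, (x.1.2 μ' h).2⟩⟩
  continuous_toFun := by
    refine Continuous.subtype_mk (Continuous.prodMk ?_ ?_) _
    · refine List.continuous_cons.comp (Continuous.prodMk ?_ ?_)
      · refine continuous_const.prodMk (List.continuous_cons.comp (Continuous.prodMk ?_ ?_))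
        · exact continuous_const.prodMk continuous_snd
        · exact continuous_const
      · refine (continuous_listMap ?_).comp
          (continuous_fst.comp (continuous_subtype_val.comp continuous_fst))
        fun_prop
    · exact continuous_snd.comp (continuous_subtype_val.comp continuous_fst)

/-- The map underlying `proj`: change all marks according to `projMark`. -/
def proj : C(LabelledGarland n m P M k, LabelledGarland n m P M k) where
  toFun x := ⟨(x.1.1.filterMap projMark, x.1.2), by
    intro μ hμ
    obtain ⟨μ', h, hμ'⟩ := List.mem_filterMap.1 hμ
    have h1 := (x.2 μ' h).1
    have h2 := (x.2 μ' h).2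
    unfold projMark at hμ'
    split_ifs at hμ' with c1 c2 c3 <;> cases hμ'
    · exact ⟨by change 1 ≤ μ'.1 - 1; omega, h2⟩
    · exact ⟨Nat.le_add_left _ _, h2⟩
    · exact ⟨h1, h2⟩⟩
  continuous_toFun := by
    refine Continuous.subtype_mk (Continuous.prodMk ?_ ?_) _
    · exact projMark_continuous.comp (continuous_fst.comp continuous_subtype_val)
    · exact continuous_snd.comp continuous_subtype_val

lemma proj_relabel (σ : Equiv.Perm (Fin k)) (x : LabelledGarland n m P M k) :
    proj (relabel σ x) = relabel σ (proj x) := by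
  apply Subtype.ext
  apply Prod.ext
  · change (List.map _ _).filterMap _ = (List.filterMap _ _).map _
    rw [List.filterMap_map, List.map_filterMap]
    congr 1
    funext μ
    simp only [Function.comp_apply, projMark, List.length_map]
    split_ifs <;> rfl
  · rfl

lemma addMark_relabel (σ : Equiv.Perm (Fin k)) (j : Fin k) (x : LabelledGarland n m P M k) (p : P) :
    addMark (σ j) (relabel σ x, p) = relabel σ (addMark j (x, p)) := by
  apply Subtype.ext
  apply Prod.ext
  · change (1, [(σ j, p)]) :: List.map _ (List.map _ x.1.1) =
      List.map (fun μ => (μ.1, μ.2.map fun q => (σ q.1, q.2)))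
        ((1, [(j, p)]) :: List.map _ x.1.1)
    simp
  · rfl

end LabelledGarland

section

variable (n m : ℕ) (P : Type u) [TopologicalSpace P] [ChartedSpace (EuclideanSpace ℝ (Fin n)) P]
  (M : Type v) [TopologicalSpace M] [ChartedSpace (EuclideanSpace ℝ (Fin m)) M]

/-- The space `𝒩` of multimarked maps: the disjoint union of `M`, and, for each `k ≥ 1`, of the
quotient by the permutations of the copies of `P` of the space of multimarked maps from `k` labelled
copies of `P`. -/
def GarlandSpace : Type (max u v) :=
  M ⊕ (Σ k : ℕ, Quotient (LabelledGarland.setoid (n := n) (m := m) (P := P) (M := M) (k := k + 1)))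

instance : TopologicalSpace (GarlandSpace n m P M) :=
  inferInstanceAs (TopologicalSpace (_ ⊕ _))

end

namespace GarlandSpace

variable {n m : ℕ} {P : Type u} [TopologicalSpace P] [ChartedSpace (EuclideanSpace ℝ (Fin n)) P]
  {M : Type v} [TopologicalSpace M] [ChartedSpace (EuclideanSpace ℝ (Fin m)) M]

variable (n m P M) in
/-- The inclusion `M = 𝒩(0; 0) → 𝒩`. -/
def ofPoint : C(M, GarlandSpace n m P M) where
  toFun := Sum.inl
  continuous_toFun := continuous_inl

/-- Forgetting the labels of the copies of `P`. -/
def ofLabelled (k : ℕ) : C(LabelledGarland n m P M (k + 1), GarlandSpace n m P M) where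
  toFun x := Sum.inr ⟨k, Quotient.mk _ x⟩
  continuous_toFun := continuous_inr.comp (continuous_sigmaMk.comp continuous_quotient_mk')

lemma ofLabelled_relabel (k : ℕ) (σ : Equiv.Perm (Fin (k + 1)))
    (x : LabelledGarland n m P M (k + 1)) : ofLabelled k (x.relabel σ) = ofLabelled k x := by
  have h : (⟦x.relabel σ⟧ : Quotient (LabelledGarland.setoid (k := k + 1))) = ⟦x⟧ :=
    Quotient.sound (Setoid.symm ⟨σ, rfl⟩)
  exact congrArg (fun y => (Sum.inr ⟨k, y⟩ : M ⊕ (Σ k : ℕ, Quotient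
    (LabelledGarland.setoid (n := n) (m := m) (P := P) (M := M) (k := k + 1))))) h

/-- The map `𝒩 → 𝒩` which changes the marks according to `projMark` and is the identity on `M`. -/
def projMap : C(GarlandSpace n m P M, GarlandSpace n m P M) where
  toFun := Sum.map id (Sigma.map id fun _ => Quotient.map LabelledGarland.proj (by
    rintro x _ ⟨σ, rfl⟩
    exact ⟨σ, (LabelledGarland.proj_relabel σ x).symm⟩))
  continuous_toFun := by
    refine Continuous.sumMap continuous_id (Continuous.sigma_map fun k => ?_)
    exact Continuous.quotient_map' LabelledGarland.proj.continuous _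

end GarlandSpace

section

variable (n m : ℕ) (P : Type u) [TopologicalSpace P] [ChartedSpace (EuclideanSpace ℝ (Fin n)) P]
  (M : Type v) [TopologicalSpace M] [ChartedSpace (EuclideanSpace ℝ (Fin m)) M]

/-- The homomorphism `proj : Ω_d(𝒩) → Ω_d(𝒩)`. -/
def proj (d : ℕ) : Bordism.{u} d (GarlandSpace n m P M) →+ Bordism.{u} d (GarlandSpace n m P M) :=
  Bordism.map GarlandSpace.projMap

/-! ### Singular manifolds in `𝒩` with adjoint maps

The operation `lift` is defined on a singular manifold `F → 𝒩` with `F` connected through its adjoint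
`F × N → M`, `N` being a disjoint union of copies of `P`, that is, through a lift of `F → 𝒩` to a
space of labelled garlands (or to `M`), which is unique only up to relabelling. -/

/-- The subgroup generated by the differences `σ_* x - x`. -/
def relabellingRelations (d k : ℕ) : AddSubgroup (Bordism.{u} d (LabelledGarland n m P M k)) :=
  AddSubgroup.closure {z | ∃ (σ : Equiv.Perm (Fin k)) (x : Bordism.{u} d (LabelledGarland n m P M k)),
    z = Bordism.map (LabelledGarland.relabel σ) x - x}

/-- The group of bordism classes of singular manifolds in `𝒩` together with an adjoint map, which is
given up to permutations of the copies of `P`; the bordisms are also required to have adjoint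
maps.  It is the direct sum of `Ω_d(M)` and, for `k ≥ 1`, of the quotients of
`Ω_d(LabelledGarland n m P M k)` by the relation `σ_* x = x` for all permutations `σ`. -/
def AdjointBordism (d : ℕ) : Type (max (u + 1) v) :=
  Bordism.{u} d M × DirectSum ℕ fun k =>
    Bordism.{u} d (LabelledGarland n m P M (k + 1)) ⧸ relabellingRelations.{u} n m P M d (k + 1)

instance (d : ℕ) : AddCommGroup (AdjointBordism.{u} n m P M d) :=
  inferInstanceAs (AddCommGroup (_ × _))

end

namespace AdjointBordism

variable (n m : ℕ) (P : Type u) [TopologicalSpace P] [ChartedSpace (EuclideanSpace ℝ (Fin n)) P]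
  (M : Type v) [TopologicalSpace M] [ChartedSpace (EuclideanSpace ℝ (Fin m)) M]

/-- Forgetting the adjoint map: the homomorphism to `Ω_d(𝒩)`. -/
def toBordism (d : ℕ) : AdjointBordism.{u} n m P M d →+ Bordism.{u} d (GarlandSpace n m P M) :=
  AddMonoidHom.coprod (Bordism.map (GarlandSpace.ofPoint n m P M))
    (DirectSum.toAddMonoid fun k => QuotientAddGroup.lift _ (Bordism.map (GarlandSpace.ofLabelled k))
      (by
        rw [relabellingRelations, AddSubgroup.closure_le]
        rintro _ ⟨σ, x, rfl⟩
        have : (Bordism.map.{u} (d := d) (GarlandSpace.ofLabelled k)).comp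
            (Bordism.map (LabelledGarland.relabel σ)) =
            Bordism.map (GarlandSpace.ofLabelled (n := n) (m := m) (P := P) (M := M) k) := by
          refine Bordism.hom_ext fun s => ?_
          simp only [AddMonoidHom.comp_apply, Bordism.map_mk, ← ContinuousMap.comp_assoc]
          congr 3
          ext1 y
          exact GarlandSpace.ofLabelled_relabel k σ y
        rw [SetLike.mem_coe, AddMonoidHom.mem_ker, map_sub, ← AddMonoidHom.comp_apply, this,
          sub_self]))

/-- The homomorphism `proj`, for singular manifolds with adjoint maps. -/
def proj (d : ℕ) : AdjointBordism.{u} n m P M d →+ AdjointBordism.{u} n m P M d :=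
  AddMonoidHom.prodMap (AddMonoidHom.id _) (DirectSum.map fun k =>
    QuotientAddGroup.map _ _ (Bordism.map LabelledGarland.proj) (by
      rw [relabellingRelations, AddSubgroup.closure_le]
      rintro _ ⟨σ, x, rfl⟩
      refine AddSubgroup.subset_closure ⟨σ, Bordism.map LabelledGarland.proj x, ?_⟩
      rw [map_sub, ← AddMonoidHom.comp_apply, ← AddMonoidHom.comp_apply]
      congr 2
      refine Bordism.hom_ext fun s => ?_
      simp only [AddMonoidHom.comp_apply, Bordism.map_mk, ← ContinuousMap.comp_assoc]
      congr 3
      ext1 y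
      exact LabelledGarland.proj_relabel σ y))

variable {P} [IsManifold (𝓡 n) ∞ P] [CompactSpace P] [T2Space P]

/-- `lift` for `k` labelled copies `P₁, …, P_k` of `P`: the class of `φ : F → LabelledGarland n m P M k`
is sent to the class of `F × (P₁ ⊔ ⋯ ⊔ P_k)` with the map that adds to `φ f` the mark `{p}`.  The
manifold is the disjoint union of the products `F × P_j`, so that its class is the sum of those of
`F × P_j`. -/
def liftLabelled (o : ManifoldOrientation (𝓡 n) P) (d k : ℕ) :
    Bordism.{u} d (LabelledGarland n m P M k) →+ Bordism.{u} (d + n) (LabelledGarland n m P M k) :=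
  ∑ j : Fin k, Bordism.cross (ClosedManifold.of n P o) (LabelledGarland.addMark j)

/-- The homomorphism `lift`.  On the summand `Ω_d(M)`, it sends `φ : F → M` to the composition of the
projection `F × P → F` and `φ`. -/
def lift (o : ManifoldOrientation (𝓡 n) P) (d : ℕ) :
    AdjointBordism.{u} n m P M d →+ AdjointBordism.{u} n m P M (d + n) :=
  AddMonoidHom.prodMap
    (Bordism.cross (ClosedManifold.of n P o) (ContinuousMap.fst (α := M) (β := P)))
    (DirectSum.map fun k => QuotientAddGroup.map _ _ (liftLabelled n m M o d (k + 1)) (by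
      rw [relabellingRelations, AddSubgroup.closure_le]
      rintro _ ⟨σ, x, rfl⟩
      refine AddSubgroup.subset_closure ⟨σ, liftLabelled n m M o d (k + 1) x, ?_⟩
      rw [map_sub, ← AddMonoidHom.comp_apply, ← AddMonoidHom.comp_apply]
      congr 2
      refine Bordism.hom_ext fun s => ?_
      simp only [AddMonoidHom.comp_apply, Bordism.map_mk, liftLabelled, AddMonoidHom.finsetSum_apply,
        map_sum, Bordism.cross_mk]
      refine (Fintype.sum_equiv σ _ _ fun j => ?_).symm
      congr 2
      ext1 y
      exact (LabelledGarland.addMark_relabel σ j _ _).symm))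

end AdjointBordism

/-- `β ∈ Ω_{d+n}(𝒩)` is a value of `lift` on `α ∈ Ω_d(𝒩)`, computed from some singular manifold with
adjoint maps that represents `α`. -/
def IsLift (n m : ℕ) {P : Type u} [TopologicalSpace P] [ChartedSpace (EuclideanSpace ℝ (Fin n)) P]
    [IsManifold (𝓡 n) ∞ P] [CompactSpace P] [T2Space P] (o : ManifoldOrientation (𝓡 n) P)
    (M : Type v) [TopologicalSpace M] [ChartedSpace (EuclideanSpace ℝ (Fin m)) M] {d : ℕ}
    (α : Bordism.{u} d (GarlandSpace n m P M)) (β : Bordism.{u} (d + n) (GarlandSpace n m P M)) :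
    Prop :=
  ∃ a : AdjointBordism.{u} n m P M d, AdjointBordism.toBordism n m P M d a = α ∧
    AdjointBordism.toBordism n m P M (d + n) (AdjointBordism.lift n m M o d a) = β

end Garlands

end

open Garlands

open Garlands

noncomputable section

namespace Garlands

/-! The composite `proj` ∘ `lift` forgets the point that `lift` adds. The new mark `{p}` has grading
1 and a single element, so `proj` erases it. Every older mark has grading g ≥ 1, which `lift` raises
to g + 1 ≠ 1 and `proj` lowers back to g. So for each copy `P_j` the composite sends `[F, φ]` to the
class of F × P → F followed by φ, a map that does not depend on the coordinate in P
(`LabelledGarland.proj_addMark`). On the summand from M the operation `lift` already has this form,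
and `proj` is the identity there.

If P = ∂W, such a class vanishes: φ composed with the projection F × W → F extends the map over F ×
W, whose oriented boundary is F × P (`IsOrientedBoundary.prodBounded`, `Bordism.cross_eq_zero`). The
delicate point is the orientation, because ∂W is the second factor while the convention puts the
outward normal first.

Each copy of P contributes zero separately, already before relabellings are divided out, so the
composite vanishes with adjoint maps (`AdjointBordism.proj_comp_lift`). The statement in the bordism
of 𝒩 itself follows because forgetting adjoint maps commutes with `proj` (`proj_comp_toBordism`). -/

/-! ### The product F × W and its oriented boundary -/

/-- The order "first vector of the second basis, first basis, rest of the second basis" of the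
vectors of a product basis. -/
def consSumEquiv (d n : ℕ) : Fin d ⊕ Fin (n + 1) ≃ Fin (d + n + 1) :=
  (Equiv.sumCongr (Equiv.refl _) (finSuccEquiv n)).trans <|
    (Equiv.sumCongr (Equiv.refl _) (Equiv.optionEquivSumPUnit.{0} _)).trans <|
      (Equiv.sumAssoc _ _ _).symm.trans <|
        (Equiv.sumCongr finSumFinEquiv (Equiv.refl _)).trans <|
          (Equiv.optionEquivSumPUnit.{0} _).symm.trans (finSuccEquiv (d + n)).symm

lemma consSumEquiv_inl {d n : ℕ} (i : Fin d) :
    consSumEquiv d n (Sum.inl i) = (finSumFinEquiv (Sum.inl i : Fin d ⊕ Fin n)).succ := by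
  simp [consSumEquiv]

lemma consSumEquiv_inr_zero {d n : ℕ} : consSumEquiv d n (Sum.inr 0) = 0 := by
  simp [consSumEquiv]

lemma consSumEquiv_inr_succ {d n : ℕ} (j : Fin n) :
    consSumEquiv d n (Sum.inr j.succ) = (finSumFinEquiv (Sum.inr j : Fin d ⊕ Fin n)).succ := by
  simp [consSumEquiv]

/-- The product of a closed oriented manifold and a compact oriented manifold with boundary, oriented
so that its boundary is the product of the first factor and the boundary of the second. -/
def ClosedManifold.prodBounded {d n : ℕ} (F : ClosedManifold.{u} d)
    (W : BoundedManifold.{u} (n + 1)) : BoundedManifold.{u} (d + n + 1) :=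
  haveI := W.basis.finiteDimensional_of_finite
  haveI := F.basis.finiteDimensional_of_finite
  { carrier := F.carrier × W.carrier
    E := F.E × W.E
    H := ModelProd F.H W.H
    I := F.I.prod W.I
    ℓ := W.ℓ.comp (ContinuousLinearMap.snd ℝ F.E W.E)
    ℓ_ne_zero := fun h => W.ℓ_ne_zero <| by
      ext x
      simpa using congrArg (fun f => f (0, x)) h
    range_I := by
      rw [ModelWithCorners.range_prod, W.range_I, F.I.range_eq_univ]
      ext x
      simp
    -- For the usual product orientation, ∂(F × W) = (-1)^d F × ∂W. Moving the first vector of the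
    -- basis of `W` in front of the d vectors of `F` changes the orientation by the same sign and
    -- cancels it.
    basis := (F.basis.prod W.basis).reindex (consSumEquiv d n)
    orientation := F.orientation.prod W.orientation }

/-- In the order given by `consSumEquiv` the frame splits into the basis `b` of the first factor and
the frame (ν, A c₁, …, A c_n) of the second, so its matrix is block diagonal with an identity block.
Nothing but `A 0 = 0` is asked of `A`, since the product basis feeds it only zero and the vectors `c
i`. -/
lemma det_cons_prod {d n : ℕ} {E E' V : Type*} [AddCommGroup E] [Module ℝ E] [AddCommGroup E']
    [Module ℝ E'] [AddCommGroup V] [Module ℝ V] (b : Basis (Fin d) ℝ E)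
    (b' : Basis (Fin (n + 1)) ℝ E') (c : Basis (Fin n) ℝ V) (A : V → E') (hA : A 0 = 0) (ν : E') :
    ((b.prod b').reindex (consSumEquiv d n)).det
      (Fin.cons (0, ν) fun i => Prod.map id A (((b.prod c).reindex finSumFinEquiv) i)) =
    b'.det (Fin.cons ν fun i => A (c i)) := by
  rw [Basis.det_reindex, Basis.det_apply, Basis.det_apply]
  have key : (Fin.cons (0, ν) fun i => Prod.map id A (((b.prod c).reindex finSumFinEquiv) i) :
        Fin (d + n + 1) → E × E') ∘ consSumEquiv d n =
      Sum.elim (fun i => (b i, 0))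
        (fun j => (0, (Fin.cons ν fun i => A (c i) : Fin (n + 1) → E') j)) := by
    funext s
    rcases s with i | j
    · rw [Function.comp_apply, consSumEquiv_inl, Fin.cons_succ]
      simp [Basis.reindex_apply, hA]
    · refine Fin.cases ?_ (fun j => ?_) j
      · rw [Function.comp_apply, consSumEquiv_inr_zero, Fin.cons_zero]
        rfl
      · rw [Function.comp_apply, consSumEquiv_inr_succ, Fin.cons_succ]
        simp [Basis.reindex_apply]
  rw [key]
  have : (b.prod b').toMatrix (Sum.elim (fun i => (b i, 0))
      (fun j => (0, (Fin.cons ν fun i => A (c i) : Fin (n + 1) → E') j))) =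
      Matrix.fromBlocks 1 0 0 (b'.toMatrix (Fin.cons ν fun i => A (c i))) := by
    ext s t
    rcases s with s | s <;> rcases t with t | t <;>
      simp [Basis.toMatrix_apply, Matrix.one_apply, Finsupp.single_apply, eq_comm]
  rw [this, Matrix.det_fromBlocks_zero₁₂, Matrix.det_one, one_mul]

/-- Since F has no boundary, the boundary of F × W comes from ∂W alone. The orientation condition
reduces to the one for W: the determinants agree by `det_cons_prod`, and the chart signs of F
cancel. This is the mirror image of `IsOrientedBoundary.prod`, with the bounded factor second. -/
lemma IsOrientedBoundary.prodBounded {d n r : ℕ} {W : BoundedManifold.{u} (n + 1)}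
    {P : Fin r → ClosedManifold.{u} n} {e : ∀ j, (P j).carrier → W.carrier}
    (h : IsOrientedBoundary W P e) (F : ClosedManifold.{u} d) :
    IsOrientedBoundary (F.prodBounded W) (fun j => F.prod (P j)) (fun j => Prod.map id (e j)) where
  smooth j := contMDiff_id.prodMap (h.smooth j)
  embedding j := IsEmbedding.id.prodMap (h.embedding j)
  disjoint i j hij := by
    refine Set.disjoint_left.2 ?_
    rintro _ ⟨x, rfl⟩ ⟨y, hy⟩
    exact Set.disjoint_left.1 (h.disjoint hij) ⟨x.2, rfl⟩ ⟨y.2, congrArg Prod.snd hy⟩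
  range_eq := by
    have : (F.prodBounded W).I.boundary (F.prodBounded W).carrier =
        (univ : Set F.carrier) ×ˢ (W.I.boundary W.carrier) :=
      ModelWithCorners.boundary_of_boundaryless_left
    rw [this, ← h.range_eq]
    ext x
    constructor
    · rintro ⟨_, ⟨j, rfl⟩, y, rfl⟩
      exact ⟨trivial, mem_iUnion.2 ⟨j, y.2, rfl⟩⟩
    · rintro ⟨-, hx⟩
      obtain ⟨j, y, hy⟩ := mem_iUnion.1 hx
      exact mem_iUnion.2 ⟨j, (x.1, y), Prod.ext rfl hy⟩
  oriented j x := by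
    obtain ⟨ν, hν, hpos⟩ := h.oriented j x.2
    -- The functional `ℓ` of the product reads only the W-component, so an outward vector of W
    -- remains outward.
    refine ⟨(0, ν), hν, ?_⟩
    have hm : mfderiv (F.I.prod (P j).I) (F.I.prod W.I) (Prod.map id (e j)) x =
        (mfderiv F.I F.I id x.1).prodMap (mfderiv (P j).I W.I (e j) x.2) :=
      mfderiv_prodMap (p := x) (mdifferentiableAt_id (I := F.I) (x := x.1))
        (((h.smooth j).mdifferentiable (by simp)) x.2)
    rw [mfderiv_id] at hm
    have hd := det_cons_prod F.basis W.basis (P j).basis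
      (fun v => (mfderiv (P j).I W.I (e j) x.2 v : W.E)) (map_zero _) ν
    refine lt_of_lt_of_eq hpos ?_
    have hs : ((F.prod (P j)).orientation.sign x *
        (F.prodBounded W).orientation.sign (Prod.map id (e j) x) : ℤˣ) =
        (P j).orientation.sign x.2 * W.orientation.sign (e j x.2) := by
      change (F.orientation.sign x.1 * (P j).orientation.sign x.2) *
        (F.orientation.sign x.1 * W.orientation.sign (e j x.2)) = _
      -- The sign of F at `x.1` occurs once in the boundary and once in the product F × W, and its
      -- square is 1.
      rw [mul_mul_mul_comm, Int.units_mul_self, one_mul]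
    rw [hs, ← hd]
    refine congrArg _ (congrArg _ (congrArg (Fin.cons _) (funext fun i => ?_)))
    exact (DFunLike.congr_fun hm ((F.basis.prod (P j).basis).reindex finSumFinEquiv i)).symm

/-! ### Vanishing of classes pulled back along F × P → F -/

/-- If `P` bounds, then so does `F × P → F → Y`. -/
lemma Bordism.cross_eq_zero {d n : ℕ} {X Y : Type*} [TopologicalSpace X] [TopologicalSpace Y]
    {P : ClosedManifold.{u} n} (hP : P.IsBoundary) (g : C(X × P.carrier, Y)) (g₀ : C(X, Y))
    (hg : ∀ x p, g (x, p) = g₀ x) : Bordism.cross.{u} (d := d) P g = 0 := by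
  obtain ⟨W, e, he⟩ := hP
  refine Bordism.hom_ext fun s => ?_
  rw [Bordism.cross_mk, AddMonoidHom.zero_apply]
  -- The singular null-bordism is F × W → F → Y, with F × P as its only boundary piece. The
  -- hypothesis `hg` says exactly that it restricts to the given map there.
  have h := Bordism.sum_mk_eq_zero (s.F.prodBounded W)
    ((g₀.comp s.f).comp (ContinuousMap.fst (α := s.F.carrier) (β := W.carrier))) 1
    (fun _ => ⟨s.F.prod P, g.comp (s.f.prodMap (ContinuousMap.id _))⟩)
    (fun j => Prod.map id (e j)) (he.prodBounded s.F) (fun _ x => hg (s.f x.1) x.2)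
  simpa using h

lemma Bordism.map_comp_cross {d n : ℕ} {X Y Z : Type*} [TopologicalSpace X] [TopologicalSpace Y]
    [TopologicalSpace Z] (P : ClosedManifold.{u} n) (g : C(X × P.carrier, Y)) (h : C(Y, Z)) :
    (Bordism.map h).comp (Bordism.cross.{u} (d := d) P g) = Bordism.cross P (h.comp g) :=
  Bordism.hom_ext fun s => by
    simp only [AddMonoidHom.comp_apply, Bordism.cross_mk, Bordism.map_mk]
    rfl

lemma Bordism.map_comp {d : ℕ} {X Y Z : Type*} [TopologicalSpace X] [TopologicalSpace Y]
    [TopologicalSpace Z] (g : C(X, Y)) (h : C(Y, Z)) :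
    (Bordism.map h).comp (Bordism.map.{u} (d := d) g) = Bordism.map (h.comp g) :=
  Bordism.hom_ext fun s => by
    simp only [AddMonoidHom.comp_apply, Bordism.map_mk, ContinuousMap.comp_assoc]

/-! ### Cancellation of `proj` against `lift` -/

section

variable {n m : ℕ} {P : Type u} [TopologicalSpace P] [ChartedSpace (EuclideanSpace ℝ (Fin n)) P]
  {M : Type v} [TopologicalSpace M] [ChartedSpace (EuclideanSpace ℝ (Fin m)) M]

/-- `proj` erases the mark that `addMark` has added, and restores the gradings of the others. -/
lemma LabelledGarland.proj_addMark {k : ℕ} (j : Fin k) (x : LabelledGarland n m P M k) (p : P) :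
    LabelledGarland.proj (LabelledGarland.addMark j (x, p)) = x := by
  apply Subtype.ext
  apply Prod.ext
  · change List.filterMap projMark ((1, [(j, p)]) :: List.map (fun μ => (μ.1 + 1, μ.2)) x.1.1) = _
    rw [List.filterMap_cons_none (by simp [projMark]), List.filterMap_map]
    refine (List.filterMap_congr (g := some) fun μ hμ => ?_).trans List.filterMap_some
    -- Gradings have to be positive here: a grading 0 would be raised to 1 and then not be lowered
    -- again by `projMark`.
    have := (x.2 μ hμ).1
    simp [projMark, Nat.one_le_iff_ne_zero.1 this]
  · rfl

/-- Both versions of `proj` are induced by the same change of marks, so they are compatible with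
forgetting labels. This carries vanishing with adjoint maps over to the bordism of 𝒩. -/
lemma proj_comp_toBordism (d : ℕ) :
    (Garlands.proj.{u} n m P M d).comp (AdjointBordism.toBordism n m P M d) =
      (AdjointBordism.toBordism n m P M d).comp (AdjointBordism.proj n m P M d) := by
  refine AddMonoidHom.ext fun ⟨a, b⟩ => ?_
  -- On M the map `projMap` is the identity, so its composite with `ofPoint` is `ofPoint` by
  -- definition.
  have ha : Bordism.map (GarlandSpace.projMap (n := n) (m := m) (P := P) (M := M))
      (Bordism.map.{u} (GarlandSpace.ofPoint n m P M) a) =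
      Bordism.map (GarlandSpace.ofPoint n m P M) a :=
    DFunLike.congr_fun (Bordism.map_comp (GarlandSpace.ofPoint n m P M) GarlandSpace.projMap) a
  refine (map_add (Garlands.proj.{u} n m P M d) _ _).trans (congrArg₂ (· + ·) ha ?_)
  refine DFunLike.congr_fun (f := (Garlands.proj.{u} n m P M d).comp (DirectSum.toAddMonoid _))
    (g := (DirectSum.toAddMonoid _).comp (DirectSum.map _)) (DirectSum.addHom_ext fun k y => ?_) b
  obtain ⟨y, rfl⟩ := QuotientAddGroup.mk_surjective y
  simp only [AddMonoidHom.comp_apply, DirectSum.map_of, DirectSum.toAddMonoid_of]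
  -- `projMap` acts on representatives by `LabelledGarland.proj`, so the two composites from
  -- labelled garlands to 𝒩 are definitionally the same map, and functoriality suffices.
  exact DFunLike.congr_fun
    ((Bordism.map_comp (GarlandSpace.ofLabelled k) GarlandSpace.projMap).trans
      (Bordism.map_comp LabelledGarland.proj (GarlandSpace.ofLabelled k)).symm) y

variable [IsManifold (𝓡 n) ∞ P] [CompactSpace P] [T2Space P]

/-- For each copy of P, `proj` after `addMark j` is the projection that discards the added point, so
every summand is the class of a product with a boundary mapped through its first factor. -/
lemma map_proj_comp_liftLabelled {o : ManifoldOrientation (𝓡 n) P}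
    (hP : (ClosedManifold.of n P o).IsBoundary) (d k : ℕ) :
    (Bordism.map LabelledGarland.proj).comp
      (AdjointBordism.liftLabelled.{u} n m M o d k) = 0 := by
  ext x
  simp only [AdjointBordism.liftLabelled, AddMonoidHom.comp_apply, AddMonoidHom.finsetSum_apply,
    map_sum, AddMonoidHom.zero_apply]
  refine Finset.sum_eq_zero fun j _ => ?_
  rw [← AddMonoidHom.comp_apply, Bordism.map_comp_cross,
    Bordism.cross_eq_zero hP _ (ContinuousMap.id _) (LabelledGarland.proj_addMark j),
    AddMonoidHom.zero_apply]

lemma AdjointBordism.proj_comp_lift {o : ManifoldOrientation (𝓡 n) P}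
    (hP : (ClosedManifold.of n P o).IsBoundary) (d : ℕ) :
    (AdjointBordism.proj n m P M (d + n)).comp (AdjointBordism.lift.{u} n m M o d) = 0 := by
  refine AddMonoidHom.ext fun ⟨a, b⟩ => Prod.ext ?_ ?_
  -- On Ω_d(M) `proj` is the identity, so `lift` itself has to vanish.
  · exact DFunLike.congr_fun
      (Bordism.cross_eq_zero.{u} hP ContinuousMap.fst (ContinuousMap.id M) fun _ _ => rfl) a
  · refine DFunLike.congr_fun (f := (DirectSum.map _).comp (DirectSum.map _)) (g := 0)
      (DirectSum.addHom_ext fun k y => ?_) b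
    -- The composite is zero before passing to coinvariants, so any representative will do.
    obtain ⟨y, rfl⟩ := QuotientAddGroup.mk_surjective y
    simp only [AddMonoidHom.comp_apply, DirectSum.map_of, QuotientAddGroup.map_mk,
      AddMonoidHom.zero_apply]
    rw [← AddMonoidHom.comp_apply, map_proj_comp_liftLabelled hP, AddMonoidHom.zero_apply,
      QuotientAddGroup.mk_zero, map_zero]

end

end Garlands

end

theorem proposition4p3 (n m : ℕ)
    (P : Type u) [TopologicalSpace P] [ChartedSpace (EuclideanSpace ℝ (Fin n)) P]
    [IsManifold (𝓡 n) ∞ P] [CompactSpace P] [T2Space P] [ConnectedSpace P]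
    (oP : ManifoldOrientation (𝓡 n) P)
    (M : Type v) [TopologicalSpace M] [ChartedSpace (EuclideanSpace ℝ (Fin m)) M]
    [IsManifold (𝓡 m) ∞ M] [ConnectedSpace M] (_oM : ManifoldOrientation (𝓡 m) M)
    (hP : (ClosedManifold.of n P oP).IsBoundary) (d : ℕ) :
    (AdjointBordism.proj n m P M (d + n)).comp (AdjointBordism.lift n m M oP d) = 0 ∧
    ∀ (α : Bordism.{u} d (GarlandSpace n m P M)) (β : Bordism.{u} (d + n) (GarlandSpace n m P M)),
      IsLift n m oP M α β → proj n m P M (d + n) β = 0 := by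
  refine ⟨AdjointBordism.proj_comp_lift hP d, ?_⟩
  rintro _ _ ⟨a, rfl, rfl⟩
  -- With β = c(lift a), `proj` is moved inside c, where it meets `lift a`.
  rw [← AddMonoidHom.comp_apply, proj_comp_toBordism, AddMonoidHom.comp_apply,
    ← AddMonoidHom.comp_apply (AdjointBordism.proj n m P M (d + n)),
    AdjointBordism.proj_comp_lift hP, AddMonoidHom.zero_apply, map_zero]
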